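/- Let $X$ be a finite connected CW complex of dimension $d\ge 1$. Let $C_j(X;A)$ denote its cellular chain groups with coefficients in $A\in\{\mathbb Z,\mathbb R\}$, with boundary operator $\partial$; equip $C_j(X;\mathbb R)$ with the standard inner product, for which the $j$-cells form an orthonormal basis, and let $B_{d-1}(X;A)=\partial(C_d(X;A))\subset C_{d-1}(X;A)$ be the group of boundaries. Let $\partial^*\colon C_{d-1}(X;\mathbb R)\to C_d(X;\mathbb R)$ be the adjoint of $\partial$, and let $$\mathcal L=\partial\partial^*\colon B_{d-1}(X;\mathbb R)\to B_{d-1}(X;\mathbb R)$$ be the combinatorial Laplacian, restricted to $B_{d-1}(X;\mathbb R)$. A spanning tree of $X$ is a subcomplex $T\subset X$ that contains the $(d-1)$-skeleton of $X$ and satisfies $H_d(T;\mathbb Z)=0$ and $\beta_{d-1}(T)=\beta_{d-1}(X)$, where $\beta_k$ denotes the $k$-th Betti number, $\beta_k(Y)=\dim_{\mathbb R}H_k(Y;\mathbb R)$. Let $\theta_T$ and $\theta_X$ be the orders of the torsion subgroups of $H_{d-1}(T;\mathbb Z)$ and $H_{d-1}(X;\mathbb Z)$ respectively, and let $\mu_X$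 be the square of the covolume of the lattice $B_{d-1}(X;\mathbb Z)\subset B_{d-1}(X;\mathbb R)$ with respect to the restriction of the standard inner product of $C_{d-1}(X;\mathbb R)$. Then $\mu_X$ is a natural number and $$\det\mathcal L=\gamma_X\sum_T\theta_T^2,\qquad \gamma_X=\frac{\mu_X}{\theta_X^2},$$ where the sum is over all spanning trees $T$ of $X$. -/

import Mathlib

open Topology

namespace HigherMatrixTree

noncomputable section

/-! ### Singular chains and relative singular homology of pairs of subsets of a space -/

section Singular

variable {X : Type*} [TopologicalSpace X]

/-- The group of integral singular `k`-chains of `X`: the free abelian group on the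
continuous maps from the standard `k`-simplex to `X`. -/
abbrev SingularChain (X : Type*) [TopologicalSpace X] (k : ℕ) : Type _ :=
  C(stdSimplex ℝ (Fin (k + 1)), X) →₀ ℤ

/-- The inclusion of the `i`-th face (the one opposite to the `i`-th vertex). -/
def faceMap (k : ℕ) (i : Fin (k + 2)) :
    C(stdSimplex ℝ (Fin (k + 1)), stdSimplex ℝ (Fin (k + 2))) :=
  ⟨stdSimplex.map i.succAbove, stdSimplex.continuous_map _⟩

/-- The singular boundary operator `σ ↦ ∑ i, (-1) ^ i • (σ ∘ dᵢ)`. -/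
def singularBoundary (X : Type*) [TopologicalSpace X] (k : ℕ) :
    SingularChain X (k + 1) →ₗ[ℤ] SingularChain X k :=
  ∑ i : Fin (k + 2), (-1 : ℤ) ^ (i : ℕ) •
    Finsupp.lmapDomain ℤ ℤ (fun σ : C(stdSimplex ℝ (Fin (k + 2)), X) => σ.comp (faceMap k i))

theorem singularBoundary_single (k : ℕ) (σ : C(stdSimplex ℝ (Fin (k + 2)), X)) (m : ℤ) :
    singularBoundary X k (Finsupp.single σ m) =
      ∑ i : Fin (k + 2), (-1 : ℤ) ^ (i : ℕ) • Finsupp.single (σ.comp (faceMap k i)) m := by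
  simp [singularBoundary, LinearMap.sum_apply, Finsupp.mapDomain_single]

theorem faceMap_apply_self (k : ℕ) (i : Fin (k + 2)) (t : stdSimplex ℝ (Fin (k + 1))) :
    faceMap k i t i = 0 := by
  simp [faceMap, FunOnFinite.linearMap_apply_apply, Fin.succAbove_ne]

theorem faceMap_comp (k : ℕ) (i : Fin (k + 3)) (j : Fin (k + 2)) :
    (faceMap (k + 1) (i.succAbove j)).comp (faceMap k (j.predAbove i)) =
      (faceMap (k + 1) i).comp (faceMap k j) := by
  ext1 t
  simp only [faceMap, ContinuousMap.comp_apply, ContinuousMap.coe_mk, stdSimplex.map_comp_apply]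
  congr 1
  funext x
  exact Fin.succAbove_succAbove_succAbove_predAbove i j x

theorem singularBoundary_comp (k : ℕ) (c : SingularChain X (k + 2)) :
    singularBoundary X k (singularBoundary X (k + 1) c) = 0 := by
  induction c using Finsupp.induction_linear with
  | zero => simp
  | add f g hf hg => simp [hf, hg]
  | single σ m =>
    rw [singularBoundary_single]
    simp only [map_sum, map_smul, singularBoundary_single, Finset.smul_sum, smul_smul]
    rw [← Finset.sum_product', Finset.univ_product_univ]
    refine Finset.sum_involution
      (fun p _ => ((p.1.succAbove p.2, p.2.predAbove p.1) : Fin (k + 3) × Fin (k + 2)))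
      ?_ ?_ ?_ ?_
    · rintro ⟨i, j⟩ -
      have h := faceMap_comp k i j
      simp only [ContinuousMap.comp_assoc, h, ← add_smul, ← pow_add]
      rw [Fin.neg_one_pow_succAbove_add_predAbove]
      simp [pow_add]
    · rintro ⟨i, j⟩ - - h
      exact Fin.succAbove_ne i j (congrArg Prod.fst h)
    · intro p _
      exact Finset.mem_univ _
    · rintro ⟨i, j⟩ -
      exact Prod.ext (Fin.succAbove_succAbove_predAbove i j)
        (Fin.predAbove_predAbove_succAbove i j)

/-- The singular `k`-chains of `X` all of whose simplices lie in the subset `A`, that is,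
the singular `k`-chains of the subspace `A`. -/
def chainsIn (A : Set X) (k : ℕ) : Submodule ℤ (SingularChain X k) :=
  Finsupp.supported ℤ ℤ {σ | Set.range σ ⊆ A}

/-- The relative `k`-cycles of the pair `(A, B)`. -/
def relCycles (A B : Set X) : (k : ℕ) → Submodule ℤ (SingularChain X k)
  | 0 => chainsIn A 0
  | k + 1 => chainsIn A (k + 1) ⊓ (chainsIn B k).comap (singularBoundary X k)

/-- The relative `k`-boundaries of the pair `(A, B)`. -/
def relBoundaries (A B : Set X) (k : ℕ) : Submodule ℤ (SingularChain X k) :=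
  (chainsIn A (k + 1)).map (singularBoundary X k) ⊔ chainsIn B k

/-- The relative singular homology group `H_k(A, B; ℤ)` of a pair `B ⊆ A ⊆ X`. -/
abbrev RelHomology (A B : Set X) (k : ℕ) : Type _ :=
  relCycles A B k ⧸ (relBoundaries A B k).comap (relCycles A B k).subtype

theorem singularBoundary_mem_relCycles {A B D : Set X} {k : ℕ} {c : SingularChain X (k + 1)}
    (hc : c ∈ relCycles A B (k + 1)) : singularBoundary X k c ∈ relCycles B D k := by
  cases k with
  | zero => exact hc.2
  | succ k =>
    refine ⟨hc.2, ?_⟩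
    change singularBoundary X k (singularBoundary X (k + 1) c) ∈ chainsIn D k
    rw [singularBoundary_comp]
    exact zero_mem _

/-- The connecting map `H_{k+1}(A, B) → H_k(B, D)`, `[c] ↦ [∂ c]`, of a triple `D ⊆ B ⊆ A`. -/
def connecting (A B D : Set X) (k : ℕ) : RelHomology A B (k + 1) →ₗ[ℤ] RelHomology B D k :=
  Submodule.mapQ _ _
    ((singularBoundary X k).restrict fun _ hc => singularBoundary_mem_relCycles hc) <| by
      rintro ⟨c, hc⟩ h
      rw [Submodule.mem_comap] at h
      obtain ⟨_, ⟨w, -, rfl⟩, y, hy, rfl⟩ := Submodule.mem_sup.1 h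
      refine Submodule.mem_sup_left ⟨y, hy, ?_⟩
      simp [singularBoundary_comp]

end Singular

/-! ### The fundamental class of a cell -/

/-- A continuous map from the standard `k`-simplex onto the cube `[-1, 1] ^ k`: the affine map
`t ↦ ((k + 1) * ((k + 1) * tᵢ - 1))_{1 ≤ i ≤ k}` followed by the coordinatewise retraction onto
the cube. It sends the boundary of the simplex to the boundary of the cube, it is an affine
isomorphism near the barycentre, and the barycentre is the only preimage of the centre; so it is
a map of pairs of degree `± 1`. -/
def simplexToCube (k : ℕ) (t : stdSimplex ℝ (Fin (k + 1))) : Fin k → ℝ :=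
  fun i => max (-1) (min 1 (((k : ℝ) + 1) * (((k : ℝ) + 1) * t i.succ - 1)))

theorem continuous_simplexToCube (k : ℕ) : Continuous (simplexToCube k) := by
  have h (j : Fin (k + 1)) : Continuous fun t : stdSimplex ℝ (Fin (k + 1)) => t j :=
    (continuous_apply j).comp continuous_subtype_val
  refine continuous_pi fun i => continuous_const.max (continuous_const.min ?_)
  exact continuous_const.mul ((continuous_const.mul (h i.succ)).sub continuous_const)

theorem abs_simplexToCube_le (k : ℕ) (t : stdSimplex ℝ (Fin (k + 1))) (i : Fin k) :
    ‖simplexToCube k t i‖ ≤ 1 := by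
  rw [Real.norm_eq_abs, abs_le]
  exact ⟨le_max_left _ _, max_le (by norm_num) (min_le_left _ _)⟩

theorem simplexToCube_mem_closedBall (k : ℕ) (t : stdSimplex ℝ (Fin (k + 1))) :
    simplexToCube k t ∈ Metric.closedBall (0 : Fin k → ℝ) 1 := by
  rw [mem_closedBall_zero_iff, pi_norm_le_iff_of_nonneg zero_le_one]
  exact abs_simplexToCube_le k t

theorem simplexToCube_mem_sphere (k : ℕ) (t : stdSimplex ℝ (Fin (k + 2))) (j : Fin (k + 2))
    (hj : t j = 0) : simplexToCube (k + 1) t ∈ Metric.sphere (0 : Fin (k + 1) → ℝ) 1 := by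
  have hle := simplexToCube_mem_closedBall (k + 1) t
  rw [mem_closedBall_zero_iff] at hle
  suffices h : ∃ i, ‖simplexToCube (k + 1) t i‖ = 1 by
    obtain ⟨i, hi⟩ := h
    rw [mem_sphere_zero_iff_norm]
    exact le_antisymm hle (hi ▸ norm_le_pi_norm _ i)
  rcases Fin.eq_zero_or_eq_succ j with rfl | ⟨i, rfl⟩
  · have hsum := stdSimplex.sum_eq_one t
    rw [Fin.sum_univ_succ, hj, zero_add] at hsum
    obtain ⟨i, -, hi⟩ := Finset.exists_le_of_sum_le (s := (Finset.univ : Finset (Fin (k + 1))))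
      (f := fun _ => ((k : ℝ) + 1)⁻¹) (g := fun i => t i.succ) Finset.univ_nonempty
      (by rw [hsum]; simp; field_simp; exact le_rfl)
    refine ⟨i, ?_⟩
    have hk : (0 : ℝ) < (k : ℝ) + 1 := by positivity
    have h1 : 1 ≤ ((k : ℝ) + 1) * t i.succ := by
      calc (1 : ℝ) = ((k : ℝ) + 1) * ((k : ℝ) + 1)⁻¹ := by field_simp
        _ ≤ _ := by gcongr
    have h2 : 1 ≤ (((k + 1 : ℕ) : ℝ) + 1) * ((((k + 1 : ℕ) : ℝ) + 1) * t i.succ - 1) := by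
      have h3 : ((k : ℝ) + 1)⁻¹ ≤ (((k + 1 : ℕ) : ℝ) + 1) * t i.succ - 1 := by
        push_cast
        linarith
      calc (1 : ℝ) = ((k : ℝ) + 1) * ((k : ℝ) + 1)⁻¹ := by field_simp
        _ ≤ (((k + 1 : ℕ) : ℝ) + 1) * ((k : ℝ) + 1)⁻¹ := by
          gcongr
          linarith
        _ ≤ _ := by gcongr
    have h3 : simplexToCube (k + 1) t i = 1 := by
      simp only [simplexToCube]
      rw [min_eq_left h2]
      norm_num
    rw [h3]
    norm_num
  · refine ⟨i, ?_⟩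
    have h3 : simplexToCube (k + 1) t i = -1 := by
      simp only [simplexToCube, hj]
      refine max_eq_left ((min_le_right _ _).trans ?_)
      push_cast
      nlinarith [Nat.cast_nonneg (α := ℝ) k]
    rw [h3]
    norm_num

section Cellular

variable {X : Type*} [TopologicalSpace X] (C : Set X) [CWComplex C]

/-- The singular simplex of a `k`-cell: the characteristic map of the cell, precomposed with
the map from the simplex to the cube. -/
def cellSimplex (k : ℕ) (b : RelCWComplex.cell C k) : C(stdSimplex ℝ (Fin (k + 1)), X) :=
  ⟨fun t => RelCWComplex.map k b (simplexToCube k t),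
    (RelCWComplex.continuousOn k b).comp_continuous (continuous_simplexToCube k)
      (simplexToCube_mem_closedBall k)⟩

variable [T2Space X]

theorem cellSimplex_mem_relCycles (k : ℕ) (b : RelCWComplex.cell C k) :
    Finsupp.single (cellSimplex C k b) (1 : ℤ) ∈
      relCycles (RelCWComplex.skeletonLT C (k + 1 : ℕ) : Set X) (RelCWComplex.skeletonLT C k) k := by
  have h : Finsupp.single (cellSimplex C k b) (1 : ℤ) ∈
      chainsIn (RelCWComplex.skeletonLT C (k + 1 : ℕ) : Set X) k := by
    refine Finsupp.single_mem_supported ℤ _ ?_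
    rintro _ ⟨t, rfl⟩
    exact RelCWComplex.closedCell_subset_skeletonLT k b
      ⟨_, simplexToCube_mem_closedBall k t, rfl⟩
  cases k with
  | zero => exact h
  | succ k =>
    refine ⟨h, ?_⟩
    change singularBoundary X k (Finsupp.single _ 1) ∈ chainsIn _ k
    rw [singularBoundary_single]
    refine Submodule.sum_mem _ fun i _ => Submodule.smul_mem _ _ ?_
    refine Finsupp.single_mem_supported ℤ _ ?_
    rintro _ ⟨t, rfl⟩
    exact RelCWComplex.cellFrontier_subset_skeletonLT (k + 1) b
      ⟨_, simplexToCube_mem_sphere k _ i (faceMap_apply_self k i t), rfl⟩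

/-- The relative homology group `H_k(X^{(k)}, X^{(k-1)}; ℤ)`. Here `skeletonLT C k` is the union
of the cells of dimension less than `k`, that is, the `(k-1)`-skeleton. -/
abbrev SkeletalHomology (k : ℕ) : Type _ :=
  RelHomology (RelCWComplex.skeletonLT C (k + 1 : ℕ) : Set X) (RelCWComplex.skeletonLT C k) k

/-- The fundamental class of a `k`-cell in `H_k(X^{(k)}, X^{(k-1)}; ℤ)`. -/
def cellClass (k : ℕ) (b : RelCWComplex.cell C k) : SkeletalHomology C k :=
  Submodule.Quotient.mk ⟨_, cellSimplex_mem_relCycles C k b⟩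

/-- The canonical map from the free abelian group on the `k`-cells to
`H_k(X^{(k)}, X^{(k-1)}; ℤ)`. -/
def cellClassMap (k : ℕ) : (RelCWComplex.cell C k →₀ ℤ) →ₗ[ℤ] SkeletalHomology C k :=
  Finsupp.linearCombination ℤ (cellClass C k)

/-- The connecting map `H_{k+1}(X^{(k+1)}, X^{(k)}; ℤ) → H_k(X^{(k)}, X^{(k-1)}; ℤ)`. -/
def skeletalBoundary (k : ℕ) : SkeletalHomology C (k + 1) →ₗ[ℤ] SkeletalHomology C k :=
  connecting (RelCWComplex.skeletonLT C (k + 1 + 1 : ℕ) : Set X)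
    (RelCWComplex.skeletonLT C (k + 1 : ℕ)) (RelCWComplex.skeletonLT C k) k

open Classical in
/-- The integral cellular boundary operator, as a map between the free abelian groups on the
cells: the connecting map read in the bases of fundamental classes. (The classes of the `k`-cells
do form a basis of `H_k(X^{(k)}, X^{(k-1)}; ℤ)` for every CW complex, so the second branch is
never taken; it only spares the definition a proof of that fact.) -/
def integralBoundary (k : ℕ) :
    (RelCWComplex.cell C (k + 1) →₀ ℤ) →ₗ[ℤ] (RelCWComplex.cell C k →₀ ℤ) :=
  if h : Function.Bijective (cellClassMap C k) then
    (LinearEquiv.ofBijective (cellClassMap C k) h).symm.toLinearMap ∘ₗ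
      skeletalBoundary C k ∘ₗ cellClassMap C (k + 1)
  else 0

/-- The incidence number `[b : a]` of a `(k+1)`-cell `b` and a `k`-cell `a`. -/
def incidence (k : ℕ) : Matrix (RelCWComplex.cell C k) (RelCWComplex.cell C (k + 1)) ℤ :=
  fun a b => integralBoundary C k (Finsupp.single b 1) a

/-! ### Cellular homology of a CW complex with finitely many cells in each dimension -/

instance instFintypeCell {X : Type*} [TopologicalSpace X] (C : Set X) [CWComplex C]
    [RelCWComplex.FiniteType C] (k : ℕ) : Fintype (RelCWComplex.cell C k) :=
  haveI : Finite (RelCWComplex.cell C k) := RelCWComplex.FiniteType.finite_cell k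
  Fintype.ofFinite _

variable [RelCWComplex.FiniteType C] (A : Type*) [CommRing A]

/-- The cellular boundary operator `C_{k+1}(X; A) → C_k(X; A)`, where `C_k(X; A)` is the free
`A`-module on the `k`-cells. -/
def boundary (k : ℕ) : (RelCWComplex.cell C (k + 1) → A) →ₗ[A] (RelCWComplex.cell C k → A) :=
  ((incidence C k).map (Int.cast : ℤ → A)).mulVecLin

/-- The cellular cycles `Z_k(X; A)`. -/
def cycles : (k : ℕ) → Submodule A (RelCWComplex.cell C k → A)
  | 0 => ⊤
  | k + 1 => LinearMap.ker (boundary C A k)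

/-- The cellular boundaries `B_k(X; A)`. -/
def boundaries (k : ℕ) : Submodule A (RelCWComplex.cell C k → A) :=
  LinearMap.range (boundary C A k)

/-- The cellular homology `H_k(X; A)`. -/
abbrev Homology (k : ℕ) : Type _ :=
  cycles C A k ⧸ (boundaries C A k).comap (cycles C A k).subtype

/-- The Betti number `β_k(X)`. -/
def betti (k : ℕ) : ℕ := Module.finrank ℝ (Homology C ℝ k)

/-- The order of the torsion subgroup of `H_k(X; ℤ)`. -/
def torsionOrder (k : ℕ) : ℕ := Nat.card (Submodule.torsion ℤ (Homology C ℤ k))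

/-! ### The Laplacian and the lattice of integral boundaries -/

/-- The boundary operator `C_{k+1}(X; ℝ) → C_k(X; ℝ)` between the real chain groups with the
standard inner products, for which the cells form orthonormal bases. -/
def realBoundary (k : ℕ) : EuclideanSpace ℝ (RelCWComplex.cell C (k + 1)) →ₗ[ℝ]
    EuclideanSpace ℝ (RelCWComplex.cell C k) :=
  (WithLp.linearEquiv 2 ℝ (RelCWComplex.cell C k → ℝ)).symm.toLinearMap ∘ₗ
    boundary C ℝ k ∘ₗ (WithLp.linearEquiv 2 ℝ (RelCWComplex.cell C (k + 1) → ℝ)).toLinearMap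

/-- The space `B_k(X; ℝ)`, as a subspace of the inner product space `C_k(X; ℝ)`. -/
abbrev realBoundaries (k : ℕ) : Submodule ℝ (EuclideanSpace ℝ (RelCWComplex.cell C k)) :=
  LinearMap.range (realBoundary C k)

/-- The combinatorial Laplacian `∂ ∂^*` restricted to `B_k(X; ℝ)`. -/
def laplacian (k : ℕ) : realBoundaries C k →ₗ[ℝ] realBoundaries C k :=
  (realBoundary C k ∘ₗ LinearMap.adjoint (realBoundary C k)).restrict
    fun x _ => ⟨LinearMap.adjoint (realBoundary C k) x, rfl⟩

/-- The inclusion `C_k(X; ℤ) → C_k(X; ℝ)`. -/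
def chainCast (k : ℕ) :
    (RelCWComplex.cell C k → ℤ) →ₗ[ℤ] EuclideanSpace ℝ (RelCWComplex.cell C k) where
  toFun c := WithLp.toLp 2 fun a => (c a : ℝ)
  map_add' c c' := by ext a; simp
  map_smul' m c := by ext a; simp

/-- The lattice `B_k(X; ℤ)` in `B_k(X; ℝ)`. -/
def boundaryLattice (k : ℕ) : Submodule ℤ (realBoundaries C k) :=
  ((boundaries C ℤ k).map (chainCast C k)).comap
    ((realBoundaries C k).subtype.restrictScalars ℤ)

/-- The square of the covolume of the lattice `B_k(X; ℤ)` in `B_k(X; ℝ)`, with respect to the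
Lebesgue measure of the inner product of `C_k(X; ℝ)` restricted to `B_k(X; ℝ)` (the measure that
gives volume `1` to the cube spanned by an orthonormal basis). -/
def latticeCovolumeSq (k : ℕ) : ℝ :=
  (ZLattice.covolume (boundaryLattice C k)
    (stdOrthonormalBasis ℝ (realBoundaries C k)).toBasis.addHaar) ^ 2

/-! ### Spanning trees -/

/-- A CW complex has dimension `d` if it has a `d`-cell and no cells of higher dimension. -/
def HasDimension {X : Type*} [TopologicalSpace X] (C : Set X) [CWComplex C] (d : ℕ) : Prop :=
  Nonempty (RelCWComplex.cell C d) ∧ ∀ k, d < k → IsEmpty (RelCWComplex.cell C k)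

/-- A spanning tree of a CW complex of dimension `n + 1` is a subcomplex `T` with
`H_{n+1}(T; ℤ) = 0` and `β_n(T) = β_n(X)` that contains the `n`-skeleton. -/
structure IsSpanningTree (n : ℕ) (T : RelCWComplex.Subcomplex C) : Prop where
  homology_eq_zero : Subsingleton (Homology (T : Set X) ℤ (n + 1))
  betti_eq : betti (T : Set X) n = betti C n
  skeleton_subset : (RelCWComplex.skeleton C n : Set X) ⊆ T

end Cellular

theorem finite_subcomplex {X : Type*} [TopologicalSpace X] (C : Set X) [CWComplex C]
    [RelCWComplex.Finite C] : Finite (RelCWComplex.Subcomplex C) := by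
  have := RelCWComplex.finite_cells_of_finite (C := C)
  refine Finite.of_injective
    (fun E : RelCWComplex.Subcomplex C =>
      ({x | x.2 ∈ E.I x.1} : Set (Σ n, RelCWComplex.cell C n))) fun E F h => ?_
  have hI : E.I = F.I := by
    funext n
    ext b
    exact Set.ext_iff.1 h ⟨n, b⟩
  refine SetLike.coe_injective ?_
  rw [← E.union, ← F.union, hI]

/-- The finite set of spanning trees of a finite CW complex of dimension `n + 1`. -/
def spanningTrees {X : Type*} [TopologicalSpace X] [T2Space X] (C : Set X) [CWComplex C]
    [RelCWComplex.Finite C] (n : ℕ) : Finset (RelCWComplex.Subcomplex C) :=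
  haveI := finite_subcomplex C
  (Set.toFinite {T | IsSpanningTree C n T}).toFinset

end

end HigherMatrixTree

/-! Let `D` be the integer incidence matrix between the `d`-cells and the `(d-1)`-cells, of rank
`r`. Its integral column space is the lattice of boundaries, which is free; so `D = M * N`, where
the columns of `M` form a lattice basis and `N` is surjective over `ℤ`. In the coordinates given by
`M` the operator `D * Dᵀ` becomes `(N * Nᵀ) * (Mᵀ * M)`, so its determinant splits
(`IsRankFactorization.det_laplacian`). The factor `det (Mᵀ * M)` is the Gram determinant of the
lattice basis, that is, the squared covolume (`covolume_sq_eq_det_gram`); it is an integer because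
`M` is integral.

By Cauchy–Binet (`det_mul_eq_sum_powersetCard`) the other factor, `det (N * Nᵀ)`, is the sum of
`(det N_S)²` over the sets `S` of `r` top cells. A subcomplex `T` containing the `(d-1)`-skeleton
amounts to a set `S` of top cells. Vanishing of `H_d(T)` says that the columns of `D` in `S` are
independent, and the Betti condition says that they span the real column space; together they mean
`|S| = r` and `det N_S ≠ 0` (`injective_and_finrank_eq_iff`). For such `T` the boundaries of `T`
have index `|det N_S|` among those of `X`, while the `(d-1)`-cycles agree, so `θ_T = |det N_S| *
θ_X` (`torsionCard_range_submatrix`). Summing squares gives the formula.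

The topological input is `∂ ∂ = 0` and the fact that `T` inherits the incidence numbers of `X`
(`incidence_subcomplex`). Both are proved for either branch of `integralBoundary`. -/

namespace HigherMatrixTree

open Module

/-! ### The Cauchy–Binet formula -/

section CauchyBinet

variable {R ι κ : Type*} [CommRing R] [Fintype ι] [DecidableEq ι] [Fintype κ]

/-- The rows of `A * B` are linear combinations of the rows of `B`; expand by multilinearity of the
determinant in the rows. -/
theorem det_mul_eq_sum_prod_mul_det (A : Matrix ι κ R) (B : Matrix κ ι R) :
    (A * B).det = ∑ p : ι → κ, (∏ i, A i (p i)) * (B.submatrix p id).det := by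
  have h : (A * B) = fun i => ∑ j, A i j • B j := by
    ext i k
    simp [Matrix.mul_apply, Finset.sum_apply]
  change Matrix.detRowAlternating (A * B) = _
  rw [h]
  change Matrix.detRowAlternating.toMultilinearMap _ = _
  rw [MultilinearMap.map_sum]
  refine Finset.sum_congr rfl fun p _ => ?_
  rw [MultilinearMap.map_smul_univ]
  rfl

variable [DecidableEq κ]

/-- The Cauchy–Binet formula, where the product of the maximal minors of `A` and `B` belonging to
the set `S` of columns of `A` is written as the determinant of `A * 1_S * B`. -/
theorem det_mul_eq_sum_powersetCard (A : Matrix ι κ R) (B : Matrix κ ι R) :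
    (A * B).det = ∑ S ∈ Finset.univ.powersetCard (Fintype.card ι),
      (A * Matrix.diagonal (fun j : κ => if j ∈ S then (1 : R) else 0) * B).det := by
  have hinj (p : ι → κ) (hp : ¬ Function.Injective p) : (B.submatrix p id).det = 0 := by
    simp only [Function.Injective, not_forall] at hp
    obtain ⟨i, j, hij, hne⟩ := hp
    exact Matrix.det_zero_of_row_eq hne (by ext; simp [hij])
  simp only [det_mul_eq_sum_prod_mul_det]
  rw [Finset.sum_comm]
  -- The two sides agree for each choice `p` of rows separately. If `p` is injective, its image is
  -- the only set of the right size containing every `p i`; if not, the minor has a repeated row and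
  -- vanishes.
  refine Finset.sum_congr rfl fun p _ => ?_
  by_cases hp : Function.Injective p
  · rw [Finset.sum_eq_single (Finset.univ.image p)]
    · simp [Matrix.mul_diagonal]
    · intro S hS hne
      have : ∃ i, p i ∉ S := by
        by_contra! h
        refine hne (Finset.eq_of_subset_of_card_le ?_ ?_).symm
        · intro x hx
          obtain ⟨i, -, rfl⟩ := Finset.mem_image.1 hx
          exact h i
        · rw [(Finset.mem_powersetCard.1 hS).2, Finset.card_image_of_injective _ hp,
            Finset.card_univ]
      obtain ⟨i, hi⟩ := this
      rw [Finset.prod_eq_zero (Finset.mem_univ i), zero_mul]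
      simp [Matrix.mul_diagonal, hi]
    · intro h
      refine absurd (Finset.mem_powersetCard.2 ⟨Finset.subset_univ _, ?_⟩) h
      rw [Finset.card_image_of_injective _ hp, Finset.card_univ]
  · simp [hinj p hp]

/-- Deleting the columns outside `S` leaves a square matrix times its transpose. The enumeration `e`
affects the minor only up to sign, which the square removes. -/
theorem det_mul_diagonal_mul_transpose (A : Matrix ι κ R) (S : Finset κ) (e : ι ≃ S) :
    (A * Matrix.diagonal (fun j : κ => if j ∈ S then (1 : R) else 0) * A.transpose).det =
      (A.submatrix id fun i => (e i : κ)).det ^ 2 := by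
  have h : A * Matrix.diagonal (fun j : κ => if j ∈ S then (1 : R) else 0) * A.transpose =
      (A.submatrix id fun i => (e i : κ)) * (A.submatrix id fun i => (e i : κ)).transpose := by
    ext i k
    rw [Matrix.mul_apply, Matrix.mul_apply]
    simp only [Matrix.mul_diagonal, Matrix.transpose_apply, Matrix.submatrix_apply, id]
    rw [e.sum_comp (fun j : S => A i j * A k j), Finset.sum_coe_sort S fun j => A i j * A k j]
    simp [ite_mul, Finset.sum_ite_mem]
  rw [h, Matrix.det_mul, Matrix.det_transpose, sq]

end CauchyBinet

/-! ### Covolumes and Gram determinants -/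

section Covolume

open MeasureTheory

/-- If `P` expresses `b` in an orthonormal basis, the covolume is `|det P|`, and `Pᵀ * P` is the
Gram matrix by Parseval's identity. -/
theorem covolume_sq_eq_det_gram {E ι κ : Type*} [NormedAddCommGroup E] [InnerProductSpace ℝ E]
    [FiniteDimensional ℝ E] [MeasurableSpace E] [BorelSpace E] [Fintype ι] [DecidableEq ι]
    [Fintype κ] (o : OrthonormalBasis κ ℝ E) (b : Basis ι ℝ E) :
    ZLattice.covolume (Submodule.span ℤ (Set.range b)) o.toBasis.addHaar ^ 2 =
      (Matrix.of fun i j => inner ℝ (b i) (b j)).det := by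
  classical
  -- Indexing the orthonormal basis by `ι` makes the change-of-basis matrix square; the measure is
  -- unchanged.
  let o' := o.reindex (o.toBasis.indexEquiv b)
  rw [o.addHaar_eq_volume, ← o'.addHaar_eq_volume,
    ZLattice.covolume_eq_measure_fundamentalDomain _ _
      (ZSpan.isAddFundamentalDomain b o'.toBasis.addHaar),
    ZSpan.measureReal_fundamentalDomain _ _ o'.toBasis,
    measureReal_congr (ZSpan.fundamentalDomain_ae_parallelepiped o'.toBasis _)]
  have h1 : o'.toBasis.addHaar.real (parallelepiped o'.toBasis) = 1 := by
    rw [Measure.real, Basis.addHaar_self, ENNReal.toReal_one]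
  rw [h1, mul_one, sq_abs, Basis.det_apply, sq]
  nth_rewrite 1 [← Matrix.det_transpose]
  rw [← Matrix.det_mul]
  congr 1
  ext i j
  simp [Matrix.mul_apply, Basis.toMatrix_apply, OrthonormalBasis.coe_toBasis_repr_apply,
    OrthonormalBasis.repr_apply_apply, ← o'.sum_inner_mul_inner (b i) (b j), real_inner_comm]

end Covolume

/-! ### Torsion in quotients -/

section Torsion

variable {M M' : Type*} [AddCommGroup M] [AddCommGroup M']

/-- The order of the torsion subgroup of `Z / (B ∩ Z)`. -/
noncomputable def torsionCard (Z B : Submodule ℤ M) : ℕ :=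
  Nat.card (Submodule.torsion ℤ (Z ⧸ B.comap Z.subtype))

/-- The isomorphism of subquotients induced by an isomorphism of modules. -/
noncomputable def subquotientEquiv {R N N' : Type*} [Ring R] [AddCommGroup N] [AddCommGroup N']
    [Module R N] [Module R N'] (e : N ≃ₗ[R] N') (Z B : Submodule R N) :
    (Z ⧸ B.comap Z.subtype) ≃ₗ[R]
      (Z.map e.toLinearMap ⧸ (B.map e.toLinearMap).comap (Z.map e.toLinearMap).subtype) :=
  Submodule.Quotient.equiv _ _ (e.submoduleMap Z) <| by
    ext ⟨_, y, hy, rfl⟩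
    simp only [Submodule.mem_map, Submodule.mem_comap, Submodule.subtype_apply]
    constructor
    · rintro ⟨x, hx, h⟩
      exact ⟨x, hx, congrArg Subtype.val h⟩
    · rintro ⟨x, hx, h⟩
      obtain rfl := e.injective h
      exact ⟨⟨x, hy⟩, hx, rfl⟩

theorem card_torsion_congr (e : M ≃ₗ[ℤ] M') :
    Nat.card (Submodule.torsion ℤ M) = Nat.card (Submodule.torsion ℤ M') := by
  refine Nat.card_congr (e.toEquiv.subtypeEquiv fun x => ?_)
  simp only [Submodule.mem_torsion_iff]
  refine exists_congr fun a => ?_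
  change a • x = 0 ↔ a • e x = 0
  rw [Submonoid.smul_def, Submonoid.smul_def, ← map_smul, e.map_eq_zero_iff]

theorem torsionCard_map (e : M ≃ₗ[ℤ] M') (Z B : Submodule ℤ M) :
    torsionCard (Z.map e.toLinearMap) (B.map e.toLinearMap) = torsionCard Z B :=
  (card_torsion_congr (subquotientEquiv e Z B)).symm

/-- Dividing by a finite subgroup divides the order of the torsion subgroup by its order. -/
theorem card_torsion_eq_of_surjective (f : M →ₗ[ℤ] M') (hf : Function.Surjective f)
    [Finite (LinearMap.ker f)] :
    Nat.card (Submodule.torsion ℤ M) =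
      Nat.card (LinearMap.ker f) * Nat.card (Submodule.torsion ℤ M') := by
  have hmem (x : M) : x ∈ Submodule.torsion ℤ M ↔ f x ∈ Submodule.torsion ℤ M' := by
    simp only [Submodule.mem_torsion_iff]
    constructor
    · rintro ⟨a, ha⟩
      exact ⟨a, by rw [Submonoid.smul_def] at ha ⊢; rw [← map_smul, ha, map_zero]⟩
    · rintro ⟨a, ha⟩
      rw [Submonoid.smul_def, ← map_smul] at ha
      -- If `a` kills `f x`, then `a • x` lies in the finite kernel and is killed by its order.
      have hc : (Nat.card (LinearMap.ker f)) • (⟨_, ha⟩ : LinearMap.ker f) = 0 :=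
        card_nsmul_eq_zero'
      have hpos : (Nat.card (LinearMap.ker f) : ℤ) ≠ 0 := by
        exact_mod_cast Nat.card_pos.ne'
      refine ⟨⟨Nat.card (LinearMap.ker f), mem_nonZeroDivisors_of_ne_zero hpos⟩ * a, ?_⟩
      rw [Submonoid.smul_def, Submonoid.coe_mul, mul_smul, Nat.cast_smul_eq_nsmul]
      exact congrArg Subtype.val hc
  let g : Submodule.torsion ℤ M →ₗ[ℤ] Submodule.torsion ℤ M' :=
    f.restrict fun x hx => (hmem x).1 hx
  have hg : Function.Surjective g := by
    rintro ⟨y, hy⟩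
    obtain ⟨x, rfl⟩ := hf y
    exact ⟨⟨x, (hmem x).2 hy⟩, rfl⟩
  have hker : Nat.card (LinearMap.ker g) = Nat.card (LinearMap.ker f) := by
    refine Nat.card_congr ⟨fun x => ⟨x.1.1, congrArg Subtype.val x.2⟩,
      fun x => ⟨⟨x.1, (hmem _).2 ?_⟩, Subtype.ext x.2⟩, fun _ => rfl, fun _ => rfl⟩
    rw [LinearMap.mem_ker.1 x.2]
    exact zero_mem _
  rw [Submodule.card_eq_card_quotient_mul_card (LinearMap.ker g), hker,
    Nat.card_congr (g.quotKerEquivOfSurjective hg).toEquiv, mul_comm]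

/-- The projection `Z / B' → Z / B` is surjective with kernel `B / B'`, which is finite, so torsion
orders multiply. -/
theorem torsionCard_eq_card_quotient_mul {Z B B' : Submodule ℤ M} (hB : B' ≤ B) (hZ : B ≤ Z)
    [Finite (B ⧸ B'.comap B.subtype)] :
    torsionCard Z B' = Nat.card (B ⧸ B'.comap B.subtype) * torsionCard Z B := by
  have hle : B'.comap Z.subtype ≤ B.comap Z.subtype := Submodule.comap_mono hB
  let f := Submodule.factor hle
  let g : B →ₗ[ℤ] Z ⧸ B'.comap Z.subtype := (B'.comap Z.subtype).mkQ ∘ₗ Submodule.inclusion hZ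
  have hg : LinearMap.ker g = B'.comap B.subtype := by
    ext x
    simp [g]
  have hrange : LinearMap.range g = LinearMap.ker f := by
    ext x
    obtain ⟨x, rfl⟩ := Submodule.Quotient.mk_surjective _ x
    have hf : f (Submodule.Quotient.mk x) = 0 ↔ (x : M) ∈ B :=
      Submodule.Quotient.mk_eq_zero (B.comap Z.subtype)
    rw [LinearMap.mem_range, LinearMap.mem_ker, hf]
    constructor
    · rintro ⟨y, hy⟩
      have := (Submodule.Quotient.eq _).1 hy
      have h2 : (y : M) - x ∈ B := hB this
      simpa using B.sub_mem y.2 h2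
    · intro hx
      exact ⟨⟨x, hx⟩, rfl⟩
  let e : (B ⧸ B'.comap B.subtype) ≃ₗ[ℤ] LinearMap.ker f :=
    (Submodule.quotEquivOfEq _ _ hg.symm).trans
      (g.quotKerEquivRange.trans (LinearEquiv.ofEq _ _ hrange))
  have : Finite (LinearMap.ker f) := Finite.of_equiv _ e.toEquiv
  rw [torsionCard, card_torsion_eq_of_surjective f (Submodule.factor_surjective hle), torsionCard,
    Nat.card_congr e.toEquiv]

theorem torsionCard_ne_zero [IsNoetherian ℤ M] (Z B : Submodule ℤ M) : torsionCard Z B ≠ 0 := by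
  have : Finite (Submodule.torsion ℤ (Z ⧸ B.comap Z.subtype)) :=
    Module.finite_of_fg_torsion _ (Submodule.torsion_isTorsion)
  exact Nat.card_pos.ne'

/-- The cokernel of an injective endomorphism of `ℤ ^ ι` has order `|det|`. -/
theorem card_quotient_range_mulVecLin {ι : Type*} [Fintype ι] [DecidableEq ι]
    (A : Matrix ι ι ℤ) (hA : A.det ≠ 0) :
    Nat.card ((ι → ℤ) ⧸ LinearMap.range A.mulVecLin) = A.det.natAbs := by
  have hinj : Function.Injective A.mulVecLin := by
    rw [← LinearMap.ker_eq_bot, LinearMap.ker_eq_bot']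
    intro v hv
    exact Matrix.eq_zero_of_mulVec_eq_zero hA hv
  rw [← Submodule.natAbs_det_equiv _ (LinearEquiv.ofInjective A.mulVecLin hinj)]
  have : (LinearMap.range A.mulVecLin).subtype ∘ₗ AddMonoidHom.toIntLinearMap
      ((LinearEquiv.ofInjective A.mulVecLin hinj : (ι → ℤ) ≃ₗ[ℤ] _) : (ι → ℤ) →+ _) =
      A.mulVecLin := by
    ext; rfl
  rw [this, ← Matrix.toLin'_apply', LinearMap.det_toLin']

end Torsion

/-! ### Integer matrices and their real counterparts -/

section IntegerMatrices

variable {I J K ι : Type*} [Fintype J] [Fintype K] [Fintype ι]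

/-- The real matrix with the entries of a given integer matrix. -/
abbrev realMatrix {I J : Type*} (D : Matrix I J ℤ) : Matrix I J ℝ := D.map (Int.cast : ℤ → ℝ)

theorem realMatrix_mul (A : Matrix I J ℤ) {K : Type*} (B : Matrix J K ℤ) :
    realMatrix (A * B) = realMatrix A * realMatrix B :=
  Matrix.map_mul (f := Int.castRingHom ℝ)

theorem realMatrix_det [DecidableEq ι] (A : Matrix ι ι ℤ) : (realMatrix A).det = (A.det : ℝ) :=
  (RingHom.map_det (Int.castRingHom ℝ) A).symm

/-- If `Mᵀ * M` kills `v`, then `M v` is orthogonal to itself, hence zero. -/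
theorem det_gram_ne_zero [Fintype I] [DecidableEq ι] (M : Matrix I ι ℤ)
    (hM : Function.Injective M.mulVecLin) :
    (M.transpose * M).det ≠ 0 := by
  intro h
  obtain ⟨v, hv, h0⟩ := Matrix.exists_mulVec_eq_zero_iff.2 h
  refine hv (hM ?_)
  rw [map_zero, Matrix.mulVecLin_apply, ← dotProduct_self_eq_zero]
  rw [← Matrix.mulVec_mulVec] at h0
  have : dotProduct v (M.transpose.mulVec (M.mulVec v)) = 0 := by rw [h0, dotProduct_zero]
  rwa [Matrix.dotProduct_mulVec, Matrix.vecMul_transpose] at this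

/-- Passes from `ℤ` to `ℝ` through the Gram determinant: it is nonzero over `ℤ`, stays so over `ℝ`,
and forces injectivity there. -/
theorem injective_realMatrix_mulVecLin [Fintype I] (M : Matrix I ι ℤ)
    (hM : Function.Injective M.mulVecLin) :
    Function.Injective (realMatrix M).mulVecLin := by
  classical
  have h : (realMatrix (M.transpose * M)).det ≠ 0 := by
    rw [realMatrix_det]
    exact_mod_cast det_gram_ne_zero M hM
  rw [← LinearMap.ker_eq_bot, LinearMap.ker_eq_bot']
  intro v hv
  refine Matrix.eq_zero_of_mulVec_eq_zero h ?_
  rw [Matrix.mulVecLin_apply] at hv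
  rw [realMatrix_mul, ← Matrix.mulVec_mulVec, hv, Matrix.mulVec_zero]

theorem surjective_realMatrix_mulVecLin (N : Matrix ι J ℤ)
    (hN : Function.Surjective N.mulVecLin) : Function.Surjective (realMatrix N).mulVecLin := by
  classical
  obtain ⟨P, hP⟩ := Matrix.mulVec_surjective_iff_exists_right_inverse.1 hN
  refine Matrix.mulVec_surjective_iff_exists_right_inverse.2 ⟨realMatrix P, ?_⟩
  rw [← realMatrix_mul, hP]
  simp [Matrix.map_one]

/-- An integer matrix `D = M * N` is the product of an injective and a surjective one. -/
structure IsRankFactorization (D : Matrix I J ℤ) (M : Matrix I ι ℤ) (N : Matrix ι J ℤ) : Prop where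
  eq_mul : D = M * N
  injective : Function.Injective M.mulVecLin
  surjective : Function.Surjective N.mulVecLin

/-- The integral column space is a submodule of a finite free `ℤ`-module, hence free. In a basis of
it, `M` is the inclusion and `N` is `D` with restricted codomain. -/
theorem exists_isRankFactorization (D : Matrix I J ℤ) :
    ∃ (r : ℕ) (M : Matrix I (Fin r) ℤ) (N : Matrix (Fin r) J ℤ), IsRankFactorization D M N := by
  classical
  let b := Module.finBasis ℤ (LinearMap.range D.mulVecLin)
  let f := (LinearMap.range D.mulVecLin).subtype ∘ₗ b.equivFun.symm.toLinearMap
  let g := b.equivFun.toLinearMap ∘ₗ D.mulVecLin.rangeRestrict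
  have hf : (LinearMap.toMatrix' f).mulVecLin = f := Matrix.toLin'_toMatrix' f
  have hg : (LinearMap.toMatrix' g).mulVecLin = g := Matrix.toLin'_toMatrix' g
  refine ⟨_, LinearMap.toMatrix' f, LinearMap.toMatrix' g, ?_, ?_, ?_⟩
  · rw [← LinearMap.toMatrix'_comp]
    have : f ∘ₗ g = Matrix.toLin' D := by
      refine LinearMap.ext fun v => ?_
      change ((b.equivFun.symm (b.equivFun (D.mulVecLin.rangeRestrict v)) :
        LinearMap.range D.mulVecLin) : I → ℤ) = _
      rw [LinearEquiv.symm_apply_apply]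
      rfl
    rw [this, LinearMap.toMatrix'_toLin']
  · rw [hf]
    exact (Submodule.subtype_injective _).comp b.equivFun.symm.injective
  · rw [hg]
    exact b.equivFun.surjective.comp D.mulVecLin.surjective_rangeRestrict

namespace IsRankFactorization

variable {D : Matrix I J ℤ} {M : Matrix I ι ℤ} {N : Matrix ι J ℤ}

theorem mulVecLin_eq (h : IsRankFactorization D M N) :
    D.mulVecLin = M.mulVecLin ∘ₗ N.mulVecLin := by
  rw [h.eq_mul, Matrix.mulVecLin_mul]

theorem realMatrix_mulVecLin_eq (h : IsRankFactorization D M N) :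
    (realMatrix D).mulVecLin = (realMatrix M).mulVecLin ∘ₗ (realMatrix N).mulVecLin := by
  rw [h.eq_mul, realMatrix_mul, Matrix.mulVecLin_mul]

theorem range_eq (h : IsRankFactorization D M N) :
    LinearMap.range D.mulVecLin = LinearMap.range M.mulVecLin := by
  rw [h.mulVecLin_eq, LinearMap.range_comp_of_range_eq_top _
    (LinearMap.range_eq_top.2 h.surjective)]

theorem range_realMatrix_eq (h : IsRankFactorization D M N) :
    LinearMap.range (realMatrix D).mulVecLin = LinearMap.range (realMatrix M).mulVecLin := by
  rw [h.realMatrix_mulVecLin_eq, LinearMap.range_comp_of_range_eq_top _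
    (LinearMap.range_eq_top.2 (surjective_realMatrix_mulVecLin N h.surjective))]

theorem finrank_range [Fintype I] (h : IsRankFactorization D M N) :
    finrank ℝ (LinearMap.range (realMatrix D).mulVecLin) = Fintype.card ι := by
  rw [h.range_realMatrix_eq,
    LinearMap.finrank_range_of_inj (injective_realMatrix_mulVecLin M h.injective),
    finrank_fintype_fun_eq_card]

theorem submatrix_mulVecLin (h : IsRankFactorization D M N) (s : K → J) :
    (D.submatrix id s).mulVecLin = M.mulVecLin ∘ₗ (N.submatrix id s).mulVecLin := by
  rw [← Matrix.mulVecLin_mul, h.eq_mul]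
  rfl

/-- A set of columns of `D` is independent and spans the same real space as all columns if and
only if it corresponds to a nonsingular maximal square submatrix of `N`. -/
theorem injective_and_finrank_eq_iff [Fintype I] [DecidableEq ι] (h : IsRankFactorization D M N)
    (s : K → J) :
    (Function.Injective (D.submatrix id s).mulVecLin ∧
      finrank ℝ (LinearMap.range (realMatrix (D.submatrix id s)).mulVecLin) =
        finrank ℝ (LinearMap.range (realMatrix D).mulVecLin)) ↔
    ∃ e : ι ≃ K, (N.submatrix id (s ∘ e)).det ≠ 0 := by
  classical
  have hinj : Function.Injective (D.submatrix id s).mulVecLin ↔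
      Function.Injective (N.submatrix id s).mulVecLin := by
    rw [h.submatrix_mulVecLin s, LinearMap.coe_comp]
    exact h.injective.of_comp_iff _
  have hdet (e : ι ≃ K) : Function.Injective (N.submatrix id s).mulVecLin ↔
      (N.submatrix id (s ∘ e)).det ≠ 0 := by
    have he : (N.submatrix id s).mulVecLin =
        (N.submatrix id (s ∘ e)).mulVecLin ∘ₗ (LinearEquiv.funCongrLeft ℤ ℤ e).toLinearMap := by
      refine LinearMap.ext fun v => funext fun i => ?_
      exact (e.sum_comp fun k => N i (s k) * v k).symm
    rw [he, LinearMap.coe_comp]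
    rw [show (⇑(LinearEquiv.funCongrLeft ℤ ℤ e).toLinearMap) =
      ⇑(LinearEquiv.funCongrLeft ℤ ℤ e).toEquiv from rfl, Equiv.injective_comp,
      ← LinearMap.ker_eq_bot, LinearMap.ker_eq_bot', ne_eq, ← Matrix.exists_mulVec_eq_zero_iff]
    push Not
    exact forall_congr' fun v => by rw [Matrix.mulVecLin_apply]; tauto
  rw [h.finrank_range]
  constructor
  -- Independent columns have rank `|K|`, so the rank condition becomes `|K| = |ι|` and the
  -- submatrix of `N` is square.
  · rintro ⟨h1, h2⟩
    rw [LinearMap.finrank_range_of_inj (injective_realMatrix_mulVecLin _ h1),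
      finrank_fintype_fun_eq_card] at h2
    exact ⟨Fintype.equivOfCardEq h2.symm, (hdet _).1 (hinj.1 h1)⟩
  · rintro ⟨e, he⟩
    have h1 := hinj.2 ((hdet e).2 he)
    refine ⟨h1, ?_⟩
    rw [LinearMap.finrank_range_of_inj (injective_realMatrix_mulVecLin _ h1),
      finrank_fintype_fun_eq_card, Fintype.card_congr e]

/-- `M` carries `ℤ ^ ι` isomorphically onto the range of `D`, and the range of the square submatrix
`A` of `N` onto the span of the selected columns. The index is therefore `|det A|`. -/
theorem torsionCard_range_submatrix [DecidableEq ι] (h : IsRankFactorization D M N)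
    (s : K → J) (e : ι ≃ K)
    (he : (N.submatrix id (s ∘ e)).det ≠ 0) {Z : Submodule ℤ (I → ℤ)}
    (hZ : LinearMap.range D.mulVecLin ≤ Z) :
    torsionCard Z (LinearMap.range (D.submatrix id s).mulVecLin) =
      (N.submatrix id (s ∘ e)).det.natAbs * torsionCard Z (LinearMap.range D.mulVecLin) := by
  classical
  set A := N.submatrix id (s ∘ e) with hA
  have hrange : LinearMap.range (D.submatrix id s).mulVecLin =
      (LinearMap.range A.mulVecLin).map M.mulVecLin := by
    have : (D.submatrix id s).mulVecLin ∘ₗ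
        (LinearEquiv.funCongrLeft ℤ ℤ e.symm).toLinearMap = M.mulVecLin ∘ₗ A.mulVecLin := by
      rw [h.submatrix_mulVecLin s, LinearMap.comp_assoc]
      congr 1
      refine LinearMap.ext fun v => funext fun i => ?_
      change ∑ k, N i (s k) * v (e.symm k) = ∑ x, N i (s (e x)) * v x
      rw [← e.sum_comp]
      simp
    rw [← LinearMap.range_comp, ← this, LinearMap.range_comp_of_range_eq_top _
      (LinearEquiv.range _)]
  let φ : (ι → ℤ) ≃ₗ[ℤ] LinearMap.range D.mulVecLin :=
    (LinearEquiv.ofInjective _ h.injective).trans (LinearEquiv.ofEq _ _ h.range_eq.symm)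
  have hφ (v : ι → ℤ) : (φ v : I → ℤ) = M.mulVecLin v := rfl
  let q : ((ι → ℤ) ⧸ LinearMap.range A.mulVecLin) ≃ₗ[ℤ] LinearMap.range D.mulVecLin ⧸
      (LinearMap.range (D.submatrix id s).mulVecLin).comap
        (LinearMap.range D.mulVecLin).subtype := by
    refine Submodule.Quotient.equiv _ _ φ ?_
    rw [hrange]
    ext x
    simp only [Submodule.mem_map, Submodule.mem_comap, Submodule.subtype_apply]
    exact exists_congr fun v => and_congr_right fun _ => by rw [← hφ]; exact Subtype.ext_iff
  have hcard := card_quotient_range_mulVecLin A he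
  have : Finite ((ι → ℤ) ⧸ LinearMap.range A.mulVecLin) :=
    Nat.finite_of_card_ne_zero (by rw [hcard]; exact Int.natAbs_ne_zero.2 he)
  have := Finite.of_equiv _ q.toEquiv
  rw [torsionCard_eq_card_quotient_mul _ hZ, ← Nat.card_congr q.toEquiv, hcard]
  rw [hrange, h.range_eq]
  exact LinearMap.map_le_range

end IsRankFactorization

end IntegerMatrices

/-! ### The Laplacian of an integer matrix -/

section Laplacian

variable {I J ι : Type*} [Fintype I] [Fintype J] [Fintype ι]

/-- The map of Euclidean spaces given by an integer matrix. -/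
noncomputable def euclideanMap (D : Matrix I J ℤ) : EuclideanSpace ℝ J →ₗ[ℝ] EuclideanSpace ℝ I :=
  (WithLp.linearEquiv 2 ℝ (I → ℝ)).symm.toLinearMap ∘ₗ
    (realMatrix D).mulVecLin ∘ₗ (WithLp.linearEquiv 2 ℝ (J → ℝ)).toLinearMap

theorem adjoint_euclideanMap (D : Matrix I J ℤ) :
    LinearMap.adjoint (euclideanMap D) = euclideanMap D.transpose := by
  symm
  rw [LinearMap.eq_adjoint_iff]
  intro x y
  rw [EuclideanSpace.inner_eq_star_dotProduct, EuclideanSpace.inner_eq_star_dotProduct,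
    dotProduct_comm, dotProduct_comm (euclideanMap D y).ofLp, star_trivial, star_trivial]
  change dotProduct ((realMatrix D.transpose).mulVec x.ofLp) y.ofLp =
    dotProduct x.ofLp ((realMatrix D).mulVec y.ofLp)
  rw [Matrix.dotProduct_mulVec, ← Matrix.mulVec_transpose]
  rfl

namespace IsRankFactorization

variable {D : Matrix I J ℤ} {M : Matrix I ι ℤ} {N : Matrix ι J ℤ}

/-- The coordinates on the real column space of `D` given by the columns of `M`. -/
noncomputable def rangeEquiv (h : IsRankFactorization D M N) :
    (ι → ℝ) ≃ₗ[ℝ] LinearMap.range (euclideanMap D) :=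
  (LinearEquiv.ofInjective
    ((WithLp.linearEquiv 2 ℝ (I → ℝ)).symm.toLinearMap ∘ₗ (realMatrix M).mulVecLin)
    ((WithLp.linearEquiv 2 ℝ (I → ℝ)).symm.injective.comp
      (injective_realMatrix_mulVecLin M h.injective))).trans <|
  LinearEquiv.ofEq _ _ <| by
    rw [euclideanMap, LinearMap.range_comp, LinearMap.range_comp,
      LinearMap.range_comp_of_range_eq_top _ (LinearEquiv.range _), h.range_realMatrix_eq]

theorem coe_rangeEquiv (h : IsRankFactorization D M N) (v : ι → ℝ) :
    (h.rangeEquiv v : EuclideanSpace ℝ I) = WithLp.toLp 2 ((realMatrix M).mulVec v) := rfl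

/-- On a vector `M v` the operator gives `M N Nᵀ Mᵀ M v`, so in the coordinates `v` it is the matrix
`(N * Nᵀ) * (Mᵀ * M)`. -/
theorem det_laplacian [DecidableEq ι] (h : IsRankFactorization D M N)
    (hD : ∀ x ∈ LinearMap.range (euclideanMap D),
      (euclideanMap D ∘ₗ LinearMap.adjoint (euclideanMap D)) x ∈
        LinearMap.range (euclideanMap D)) :
    LinearMap.det ((euclideanMap D ∘ₗ LinearMap.adjoint (euclideanMap D)).restrict hD) =
      (((N * N.transpose).det * (M.transpose * M).det : ℤ) : ℝ) := by
  have hconj : (euclideanMap D ∘ₗ LinearMap.adjoint (euclideanMap D)).restrict hD =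
      h.rangeEquiv.toLinearMap ∘ₗ
        Matrix.toLin' (realMatrix ((N * N.transpose) * (M.transpose * M))) ∘ₗ
          h.rangeEquiv.symm.toLinearMap := by
    refine LinearMap.ext fun x => ?_
    obtain ⟨v, rfl⟩ := h.rangeEquiv.surjective x
    refine Subtype.ext ?_
    simp only [LinearMap.coe_comp, LinearEquiv.coe_coe, Function.comp_apply,
      LinearEquiv.symm_apply_apply, coe_rangeEquiv, adjoint_euclideanMap]
    change WithLp.toLp 2 ((realMatrix D).mulVec ((realMatrix D.transpose).mulVec
      ((realMatrix M).mulVec v))) = WithLp.toLp 2 ((realMatrix M).mulVec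
        ((realMatrix ((N * N.transpose) * (M.transpose * M))).mulVec v))
    rw [Matrix.mulVec_mulVec, Matrix.mulVec_mulVec, Matrix.mulVec_mulVec]
    simp only [← realMatrix_mul]
    rw [h.eq_mul, Matrix.transpose_mul]
    simp only [Matrix.mul_assoc]
  rw [hconj, LinearMap.det_conj, LinearMap.det_toLin', realMatrix_det, Matrix.det_mul]

/-- The columns of `M`, as a basis of the real column space of `D`. -/
noncomputable def rangeBasis (h : IsRankFactorization D M N) :
    Basis ι ℝ (LinearMap.range (euclideanMap D)) :=
  Basis.ofEquivFun h.rangeEquiv.symm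

theorem coe_rangeBasis (h : IsRankFactorization D M N) (k : ι) :
    (h.rangeBasis k : EuclideanSpace ℝ I) = WithLp.toLp 2 fun i => (M i k : ℝ) := by
  classical
  rw [rangeBasis, Basis.coe_ofEquivFun, LinearEquiv.symm_symm, coe_rangeEquiv]
  simp
  rfl

theorem det_gram_rangeBasis [DecidableEq ι] (h : IsRankFactorization D M N) :
    (Matrix.of fun i j => inner ℝ (h.rangeBasis i) (h.rangeBasis j)).det =
      ((M.transpose * M).det : ℝ) := by
  rw [← realMatrix_det]
  congr 1
  ext i j
  rw [Matrix.of_apply, Submodule.coe_inner, coe_rangeBasis, coe_rangeBasis,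
    EuclideanSpace.inner_eq_star_dotProduct]
  simp [Matrix.mul_apply, dotProduct, mul_comm]

/-- Since `N` is onto over `ℤ`, the integral combinations of the columns of `M` are exactly the
images under `D` of integral vectors. -/
theorem mem_span_rangeBasis_iff (h : IsRankFactorization D M N)
    (x : LinearMap.range (euclideanMap D)) :
    x ∈ Submodule.span ℤ (Set.range h.rangeBasis) ↔
      ∃ v : J → ℤ, (WithLp.toLp 2 fun i => ((D.mulVec v i : ℤ) : ℝ)) =
        (x : EuclideanSpace ℝ I) := by
  have hw (w : ι → ℤ) : ((∑ k, w k • h.rangeBasis k : LinearMap.range (euclideanMap D)) :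
      EuclideanSpace ℝ I) = WithLp.toLp 2 fun i => ((M.mulVec w i : ℤ) : ℝ) := by
    ext i
    simp only [Submodule.coe_sum, Submodule.coe_smul_of_tower, coe_rangeBasis]
    simp [Matrix.mulVec, dotProduct, mul_comm]
  rw [Submodule.mem_span_range_iff_exists_fun]
  constructor
  · rintro ⟨w, rfl⟩
    obtain ⟨v, rfl⟩ := h.surjective w
    refine ⟨v, ?_⟩
    rw [hw, h.eq_mul, ← Matrix.mulVec_mulVec]
    rfl
  · rintro ⟨v, hv⟩
    refine ⟨N.mulVec v, Subtype.ext ?_⟩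
    rw [hw, Matrix.mulVec_mulVec, ← h.eq_mul, hv]

end IsRankFactorization

end Laplacian

/-! ### The cellular boundary operator in terms of singular chains -/

section Cellular

variable {X : Type*} [TopologicalSpace X] [T2Space X] (C : Set X) [CWComplex C]

/-- The singular chain of a formal combination of cells. -/
noncomputable def cellChain (k : ℕ) : (RelCWComplex.cell C k →₀ ℤ) →ₗ[ℤ] SingularChain X k :=
  Finsupp.linearCombination ℤ fun b => Finsupp.single (cellSimplex C k b) 1

theorem cellChain_mem_relCycles (k : ℕ) (c : RelCWComplex.cell C k →₀ ℤ) :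
    cellChain C k c ∈ relCycles (RelCWComplex.skeletonLT C (k + 1 : ℕ) : Set X)
      (RelCWComplex.skeletonLT C k) k := by
  rw [cellChain, Finsupp.linearCombination_apply]
  exact Submodule.sum_mem _ fun b _ => Submodule.smul_mem _ _ (cellSimplex_mem_relCycles C k b)

theorem cellClassMap_apply (k : ℕ) (c : RelCWComplex.cell C k →₀ ℤ) :
    cellClassMap C k c =
      Submodule.Quotient.mk ⟨cellChain C k c, cellChain_mem_relCycles C k c⟩ := by
  let f := (cellChain C k).codRestrict _ (cellChain_mem_relCycles C k)
  have h : cellClassMap C k = Submodule.mkQ _ ∘ₗ f := by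
    refine Finsupp.lhom_ext' fun b => LinearMap.ext_ring ?_
    have hb : f (Finsupp.single b 1) = ⟨_, cellSimplex_mem_relCycles C k b⟩ :=
      Subtype.ext (by simp [f, cellChain])
    simp only [LinearMap.comp_apply, Finsupp.lsingle_apply, hb]
    rw [cellClassMap, Finsupp.linearCombination_single, one_smul]
    rfl
  rw [h]
  rfl

theorem cellClassMap_eq_mk_iff (k : ℕ) (c : RelCWComplex.cell C k →₀ ℤ) (z : SingularChain X k)
    (hz : z ∈ relCycles (RelCWComplex.skeletonLT C (k + 1 : ℕ) : Set X)
      (RelCWComplex.skeletonLT C k) k) :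
    cellClassMap C k c = Submodule.Quotient.mk ⟨z, hz⟩ ↔
      cellChain C k c - z ∈ relBoundaries (RelCWComplex.skeletonLT C (k + 1 : ℕ) : Set X)
        (RelCWComplex.skeletonLT C k) k := by
  rw [cellClassMap_apply, Submodule.Quotient.eq]
  rfl

/-- Stated with chains of the ambient space instead of quotient types, so that two complexes with
equal skeleta can be compared by rewriting. -/
theorem bijective_cellClassMap_iff (k : ℕ) :
    Function.Bijective (cellClassMap C k) ↔
      (∀ c, cellChain C k c ∈ relBoundaries (RelCWComplex.skeletonLT C (k + 1 : ℕ) : Set X)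
        (RelCWComplex.skeletonLT C k) k → c = 0) ∧
      ∀ z ∈ relCycles (RelCWComplex.skeletonLT C (k + 1 : ℕ) : Set X)
        (RelCWComplex.skeletonLT C k) k,
        ∃ c, cellChain C k c - z ∈ relBoundaries (RelCWComplex.skeletonLT C (k + 1 : ℕ) : Set X)
          (RelCWComplex.skeletonLT C k) k := by
  refine and_congr ?_ ?_
  · rw [← LinearMap.ker_eq_bot, LinearMap.ker_eq_bot']
    refine forall_congr' fun c => imp_congr_left ?_
    have h := cellClassMap_eq_mk_iff C k c 0 (zero_mem _)
    rw [sub_zero] at h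
    exact h
  · constructor
    · intro h z hz
      obtain ⟨c, hc⟩ := h (Submodule.Quotient.mk ⟨z, hz⟩)
      exact ⟨c, (cellClassMap_eq_mk_iff C k c z hz).1 hc⟩
    · intro h x
      obtain ⟨⟨z, hz⟩, rfl⟩ := Submodule.Quotient.mk_surjective _ x
      obtain ⟨c, hc⟩ := h z hz
      exact ⟨c, (cellClassMap_eq_mk_iff C k c z hz).2 hc⟩

theorem cellClassMap_integralBoundary {k : ℕ} (h : Function.Bijective (cellClassMap C k))
    (c : RelCWComplex.cell C (k + 1) →₀ ℤ) :
    cellClassMap C k (integralBoundary C k c) =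
      skeletalBoundary C k (cellClassMap C (k + 1) c) := by
  rw [integralBoundary, dif_pos h]
  exact (LinearEquiv.ofBijective (cellClassMap C k) h).apply_symm_apply _

theorem skeletalBoundary_skeletalBoundary (k : ℕ) (x : SkeletalHomology C (k + 2)) :
    skeletalBoundary C k (skeletalBoundary C (k + 1) x) = 0 := by
  obtain ⟨⟨z, hz⟩, rfl⟩ := Submodule.Quotient.mk_surjective _ x
  refine (Submodule.Quotient.mk_eq_zero _).2 ?_
  rw [Submodule.mem_comap]
  change singularBoundary X k (singularBoundary X (k + 1) z) ∈ _
  rw [singularBoundary_comp]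
  exact zero_mem _

/-- When both class maps are bijective this is `∂ ∂ = 0` for connecting maps; otherwise one of the
two factors is zero by definition. -/
theorem integralBoundary_integralBoundary (k : ℕ) (c : RelCWComplex.cell C (k + 2) →₀ ℤ) :
    integralBoundary C k (integralBoundary C (k + 1) c) = 0 := by
  by_cases h : Function.Bijective (cellClassMap C k)
  · by_cases h' : Function.Bijective (cellClassMap C (k + 1))
    · refine h.1 ?_
      rw [cellClassMap_integralBoundary C h, cellClassMap_integralBoundary C h',
        skeletalBoundary_skeletalBoundary, map_zero]
    · rw [integralBoundary, integralBoundary, dif_neg h', LinearMap.zero_apply, map_zero]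
  · rw [integralBoundary, dif_neg h, LinearMap.zero_apply]

theorem cellChain_integralBoundary_sub_mem {k : ℕ} (h : Function.Bijective (cellClassMap C k))
    (c : RelCWComplex.cell C (k + 1) →₀ ℤ) :
    cellChain C k (integralBoundary C k c) - singularBoundary X k (cellChain C (k + 1) c) ∈
      relBoundaries (RelCWComplex.skeletonLT C (k + 1 : ℕ) : Set X)
        (RelCWComplex.skeletonLT C k) k := by
  refine (cellClassMap_eq_mk_iff C k _ _ (singularBoundary_mem_relCycles
    (cellChain_mem_relCycles C (k + 1) c))).1 ?_
  rw [cellClassMap_integralBoundary C h, cellClassMap_apply]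
  rfl

theorem incidence_mul_incidence [RelCWComplex.FiniteType C] (k : ℕ) :
    incidence C k * incidence C (k + 1) = 0 := by
  ext a b
  have hb := DFunLike.congr_fun (integralBoundary_integralBoundary C k (Finsupp.single b 1)) a
  set c := integralBoundary C (k + 1) (Finsupp.single b 1) with hc
  have hsum : c = ∑ m, c m • Finsupp.single m 1 := by
    ext x
    simp
  rw [hsum, map_sum, Finsupp.finsetSum_apply, Finsupp.zero_apply] at hb
  rw [Matrix.mul_apply, Matrix.zero_apply, ← hb]
  refine Finset.sum_congr rfl fun m _ => ?_
  rw [map_smul, Finsupp.smul_apply, smul_eq_mul, mul_comm]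
  rfl

theorem boundaries_le_cycles [RelCWComplex.FiniteType C] (A : Type*) [CommRing A] (k : ℕ) :
    boundaries C A k ≤ cycles C A k := by
  cases k with
  | zero => exact le_top
  | succ k =>
    rintro _ ⟨v, rfl⟩
    change ((incidence C k).map (Int.castRingHom A)).mulVec
      (((incidence C (k + 1)).map (Int.castRingHom A)).mulVec v) = 0
    rw [Matrix.mulVec_mulVec, ← Matrix.map_mul, incidence_mul_incidence,
      Matrix.map_zero _ (map_zero _), Matrix.zero_mulVec]

/-! ### Subcomplexes containing a skeleton -/

variable {C} (T : RelCWComplex.Subcomplex C)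

/-- An open cell outside `T` would be disjoint from `T`, yet it is nonempty and lies in the
skeleton. -/
theorem subcomplex_cells_eq_univ {n : ℕ} (h : (RelCWComplex.skeleton C n : Set X) ⊆ T) {m : ℕ}
    (hm : m ≤ n) : T.I m = Set.univ := by
  refine Set.eq_univ_of_forall fun j => ?_
  by_contra hj
  have hd := T.disjoint_openCell_subcomplex_of_not_mem hj
  obtain ⟨x, hx⟩ := RelCWComplex.openCell_nonempty m j
  refine Set.disjoint_left.1 hd hx (h ?_)
  exact RelCWComplex.skeleton_mono (by exact_mod_cast hm)
    (RelCWComplex.openCell_subset_skeleton m j hx)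

theorem skeletonLT_subcomplex {k : ℕ} (h : ∀ m < k, T.I m = Set.univ) :
    (RelCWComplex.skeletonLT (T : Set X) k : Set X) = RelCWComplex.skeletonLT C k := by
  ext x
  simp only [SetLike.mem_coe, CWComplex.mem_skeletonLT_iff]
  constructor
  · rintro ⟨m, hm, j, hj⟩
    exact ⟨m, hm, j.1, hj⟩
  · rintro ⟨m, hm, j, hj⟩
    exact ⟨m, hm, ⟨j, by rw [h m (by exact_mod_cast hm)]; trivial⟩, hj⟩

theorem cellChain_subcomplex (k : ℕ) (c : T.I k →₀ ℤ) :
    cellChain (T : Set X) k c = cellChain C k (c.mapDomain Subtype.val) := by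
  rw [cellChain, cellChain, Finsupp.linearCombination_mapDomain]
  rfl

/-- A subcomplex that contains the `k`-skeleton has the same incidence numbers between
`(k + 1)`-cells and `k`-cells. -/
theorem incidence_subcomplex {k : ℕ} (h : ∀ m ≤ k, T.I m = Set.univ) (a : T.I k)
    (b : T.I (k + 1)) :
    incidence (T : Set X) k a b = incidence C k a.1 b.1 := by
  have hA := skeletonLT_subcomplex T (k := k + 1) fun m hm => h m (Nat.lt_succ_iff.1 hm)
  have hB := skeletonLT_subcomplex T (k := k) fun m hm => h m hm.le
  have hval : Function.Injective
      (Finsupp.mapDomain (Subtype.val : T.I k → RelCWComplex.cell C k) : (_ →₀ ℤ) → _) :=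
    Finsupp.mapDomain_injective Subtype.val_injective
  have hsurj (c : RelCWComplex.cell C k →₀ ℤ) :
      ∃ c' : T.I k →₀ ℤ, c'.mapDomain Subtype.val = c :=
    Finsupp.mapDomain_surjective (fun b => ⟨⟨b, by rw [h k le_rfl]; trivial⟩, rfl⟩) c
  -- `T` and `C` must fall into the same branch of `integralBoundary`.
  have hiff : Function.Bijective (cellClassMap (T : Set X) k) ↔
      Function.Bijective (cellClassMap C k) := by
    rw [bijective_cellClassMap_iff, bijective_cellClassMap_iff, hA, hB]
    refine and_congr ⟨fun hT c hc => ?_, fun hC c hc => ?_⟩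
      (forall₂_congr fun z _ => ⟨?_, ?_⟩)
    · obtain ⟨c, rfl⟩ := hsurj c
      rw [hT c (by rwa [cellChain_subcomplex]), Finsupp.mapDomain_zero]
    · rw [cellChain_subcomplex] at hc
      exact hval ((hC _ hc).trans Finsupp.mapDomain_zero.symm)
    · rintro ⟨c, hc⟩
      exact ⟨_, by rwa [cellChain_subcomplex] at hc⟩
    · rintro ⟨c, hc⟩
      obtain ⟨c, rfl⟩ := hsurj c
      exact ⟨c, by rwa [cellChain_subcomplex]⟩
  by_cases hbij : Function.Bijective (cellClassMap C k)
  -- Both cellular boundaries of `b` represent the singular boundary of the same simplex modulo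
  -- relative boundaries; injectivity of the class map identifies them.
  · have h1 := cellChain_integralBoundary_sub_mem C hbij (Finsupp.single b.1 1)
    have h2 := cellChain_integralBoundary_sub_mem (T : Set X) (hiff.2 hbij) (Finsupp.single b 1)
    rw [hA, hB, cellChain_subcomplex, cellChain_subcomplex, Finsupp.mapDomain_single] at h2
    have h3 := Submodule.sub_mem _ h2 h1
    rw [sub_sub_sub_cancel_right, ← map_sub] at h3
    have h4 := sub_eq_zero.1 (((bijective_cellClassMap_iff C k).1 hbij).1 _ h3)
    rw [incidence, incidence, ← h4, Finsupp.mapDomain_apply Subtype.val_injective]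
  · rw [incidence, incidence, integralBoundary, integralBoundary, dif_neg hbij,
      dif_neg (mt hiff.1 hbij)]
    rfl

end Cellular

theorem subcomplex_eq_of_cells_eq {X : Type*} [TopologicalSpace X] {C : Set X} [CWComplex C] {n : ℕ}
    (hdim : HasDimension C (n + 1))
    {T T' : RelCWComplex.Subcomplex C} (hT : ∀ m ≤ n, T.I m = Set.univ)
    (hT' : ∀ m ≤ n, T'.I m = Set.univ) (h : T.I (n + 1) = T'.I (n + 1)) : T = T' := by
  have hI : T.I = T'.I := by
    funext m
    rcases lt_trichotomy m (n + 1) with hm | rfl | hm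
    · rw [hT m (by omega), hT' m (by omega)]
    · exact h
    · ext b
      exact ((hdim.2 m hm).false b).elim
  refine SetLike.coe_injective ?_
  rw [← T.union, ← T'.union, hI]

/-! ### Integral boundary matrices and Betti numbers -/

section Cellular

variable {X : Type*} [TopologicalSpace X] [T2Space X] {C : Set X} [CWComplex C]

theorem boundary_int [RelCWComplex.FiniteType C] (k : ℕ) :
    boundary C ℤ k = (incidence C k).mulVecLin := by
  have : (incidence C k).map (Int.cast : ℤ → ℤ) = incidence C k := by ext; simp
  rw [boundary, this]

theorem betti_add_finrank_boundaries [RelCWComplex.FiniteType C] (k : ℕ) :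
    betti C k + finrank ℝ (boundaries C ℝ k) = finrank ℝ (cycles C ℝ k) := by
  rw [← (Submodule.comapSubtypeEquivOfLe (boundaries_le_cycles C ℝ k)).finrank_eq]
  exact Submodule.finrank_quotient_add_finrank _

/-! ### Homology of subcomplexes that contain a skeleton -/

section Subcomplex

variable [RelCWComplex.FiniteType C] (T : RelCWComplex.Subcomplex C)

/-- The bijection between the `k`-cells of a subcomplex and of the whole complex if the subcomplex
contains all `k`-cells. -/
def cellEquiv {k : ℕ} (h : T.I k = Set.univ) :
    RelCWComplex.cell (T : Set X) k ≃ RelCWComplex.cell C k :=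
  Equiv.subtypeUnivEquiv fun b => by rw [h]; trivial

/-- The inclusion of the cells of a subcomplex. -/
def cellInclusion (k : ℕ) : RelCWComplex.cell (T : Set X) k → RelCWComplex.cell C k :=
  fun b : T.I k => b.1

/-- Up to renaming the `k`-cells, passing to `T` only deletes columns of the incidence matrix. -/
theorem boundary_subcomplex (A : Type*) [CommRing A] {k : ℕ} (h : ∀ m ≤ k, T.I m = Set.univ) :
    boundary (T : Set X) A k =
      (LinearEquiv.funCongrLeft A A (cellEquiv T (h k le_rfl))).toLinearMap ∘ₗ
        (((incidence C k).submatrix id (cellInclusion T (k + 1))).map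
          (Int.cast : ℤ → A)).mulVecLin := by
  refine LinearMap.ext fun v => funext fun a => ?_
  refine Finset.sum_congr rfl fun b _ => ?_
  exact congrArg (fun m : ℤ => (m : A) * v b) (incidence_subcomplex T h a b)

theorem boundaries_subcomplex (A : Type*) [CommRing A] {k : ℕ} (h : ∀ m ≤ k, T.I m = Set.univ) :
    boundaries (T : Set X) A k =
      (LinearMap.range (((incidence C k).submatrix id (cellInclusion T (k + 1))).map
        (Int.cast : ℤ → A)).mulVecLin).map
          (LinearEquiv.funCongrLeft A A (cellEquiv T (h k le_rfl))).toLinearMap := by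
  rw [boundaries, boundary_subcomplex T A h, LinearMap.range_comp]

/-- Cycles in degree `k` depend only on cells of dimension at most `k`, all of which belong to `T`.
-/
theorem cycles_subcomplex (A : Type*) [CommRing A] {k : ℕ} (h : ∀ m ≤ k, T.I m = Set.univ) :
    cycles (T : Set X) A k = (cycles C A k).map
      (LinearEquiv.funCongrLeft A A (cellEquiv T (h k le_rfl))).toLinearMap := by
  cases k with
  | zero => exact (Submodule.map_top _).trans (LinearEquiv.range _) |>.symm
  | succ k =>
    ext f
    obtain ⟨g, rfl⟩ :=
      (LinearEquiv.funCongrLeft A A (cellEquiv T (h (k + 1) le_rfl))).surjective f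
    have hk : ∀ m ≤ k, T.I m = Set.univ := fun m hm => h m (hm.trans k.le_succ)
    have hg : (((incidence C k).submatrix id (cellInclusion T (k + 1))).map
        (Int.cast : ℤ → A)).mulVecLin
          (LinearEquiv.funCongrLeft A A (cellEquiv T (h (k + 1) le_rfl)) g) =
        boundary C A k g := by
      funext a
      exact (cellEquiv T (h (k + 1) le_rfl)).sum_comp
        fun b => (incidence C k).map (Int.cast : ℤ → A) a b * g b
    change boundary (T : Set X) A k _ = 0 ↔ _
    rw [boundary_subcomplex T A hk, LinearMap.comp_apply, hg]
    refine (LinearEquiv.map_eq_zero_iff _).trans ?_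
    constructor
    · intro hg
      exact ⟨g, hg, rfl⟩
    · rintro ⟨g', hg', heq⟩
      rw [← LinearEquiv.injective _ heq]
      exact hg'

theorem torsionOrder_subcomplex {k : ℕ} (h : ∀ m ≤ k, T.I m = Set.univ) :
    torsionOrder (T : Set X) k = torsionCard (cycles C ℤ k)
      (LinearMap.range ((incidence C k).submatrix id (cellInclusion T (k + 1))).mulVecLin) := by
  have hid : ((incidence C k).submatrix id (cellInclusion T (k + 1))).map (Int.cast : ℤ → ℤ) =
      (incidence C k).submatrix id (cellInclusion T (k + 1)) := by ext; simp
  change torsionCard (cycles (T : Set X) ℤ k) (boundaries (T : Set X) ℤ k) = _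
  rw [cycles_subcomplex T ℤ h, boundaries_subcomplex T ℤ h, torsionCard_map, hid]

/-- The cycle spaces have the same dimension, so the Betti numbers agree exactly when the boundary
spaces do in dimension. -/
theorem betti_subcomplex_eq_iff {k : ℕ} (h : ∀ m ≤ k, T.I m = Set.univ) :
    betti (T : Set X) k = betti C k ↔
      finrank ℝ (LinearMap.range (realMatrix
        ((incidence C k).submatrix id (cellInclusion T (k + 1)))).mulVecLin) =
      finrank ℝ (LinearMap.range (realMatrix (incidence C k)).mulVecLin) := by
  have h1 := betti_add_finrank_boundaries (C := (T : Set X)) k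
  have h2 := betti_add_finrank_boundaries (C := C) k
  rw [cycles_subcomplex T ℝ h, boundaries_subcomplex T ℝ h] at h1
  have h3 := LinearEquiv.finrank_map_eq (LinearEquiv.funCongrLeft ℝ ℝ (cellEquiv T (h k le_rfl)))
    (cycles C ℝ k)
  have h4 := LinearEquiv.finrank_map_eq (LinearEquiv.funCongrLeft ℝ ℝ (cellEquiv T (h k le_rfl)))
    (LinearMap.range (realMatrix
        ((incidence C k).submatrix id (cellInclusion T (k + 1)))).mulVecLin)
  change _ + finrank ℝ (LinearMap.range (realMatrix (incidence C k)).mulVecLin) = _ at h2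
  change betti (T : Set X) k + finrank ℝ (Submodule.map
    (LinearEquiv.funCongrLeft ℝ ℝ (cellEquiv T (h k le_rfl))).toLinearMap _) =
      finrank ℝ (Submodule.map
    (LinearEquiv.funCongrLeft ℝ ℝ (cellEquiv T (h k le_rfl))).toLinearMap _) at h1
  have h1' := (congrArg _ h4.symm).trans (h1.trans h3)
  omega

/-- There are no `(n + 2)`-cells, so the top homology is the kernel of the boundary operator. -/
theorem subsingleton_homology_subcomplex_iff {n : ℕ} (h : ∀ m ≤ n, T.I m = Set.univ)
    (hdim : HasDimension C (n + 1)) :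
    Subsingleton (Homology (T : Set X) ℤ (n + 1)) ↔
      Function.Injective ((incidence C n).submatrix id (cellInclusion T (n + 1))).mulVecLin := by
  have hid : ((incidence C n).submatrix id (cellInclusion T (n + 1))).map (Int.cast : ℤ → ℤ) =
      (incidence C n).submatrix id (cellInclusion T (n + 1)) := by ext; simp
  have hempty : IsEmpty (RelCWComplex.cell (T : Set X) (n + 1 + 1)) :=
    ⟨fun b => (hdim.2 (n + 1 + 1) (Nat.lt_succ_self _)).false (cellInclusion T _ b)⟩
  have hbot : boundaries (T : Set X) ℤ (n + 1) = ⊥ := by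
    rw [boundaries, LinearMap.range_eq_bot]
    exact Subsingleton.elim _ _
  have hcycles : cycles (T : Set X) ℤ (n + 1) = LinearMap.ker
      ((incidence C n).submatrix id (cellInclusion T (n + 1))).mulVecLin := by
    change LinearMap.ker (boundary (T : Set X) ℤ n) = _
    rw [boundary_subcomplex T ℤ h, LinearEquiv.ker_comp, hid]
  rw [Submodule.Quotient.subsingleton_iff, Submodule.comap_subtype_eq_top, hbot, le_bot_iff,
    hcycles, LinearMap.ker_eq_bot]

theorem isSpanningTree_iff {n : ℕ} (hdim : HasDimension C (n + 1)) :
    IsSpanningTree C n T ↔ (∀ m ≤ n, T.I m = Set.univ) ∧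
      Function.Injective ((incidence C n).submatrix id (cellInclusion T (n + 1))).mulVecLin ∧
      finrank ℝ (LinearMap.range (realMatrix
        ((incidence C n).submatrix id (cellInclusion T (n + 1)))).mulVecLin) =
      finrank ℝ (LinearMap.range (realMatrix (incidence C n)).mulVecLin) := by
  constructor
  · rintro ⟨h1, h2, h3⟩
    have h : ∀ m ≤ n, T.I m = Set.univ := fun m hm => subcomplex_cells_eq_univ T h3 hm
    exact ⟨h, (subsingleton_homology_subcomplex_iff T h hdim).1 h1,
      (betti_subcomplex_eq_iff T h).1 h2⟩
  · rintro ⟨h, h1, h2⟩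
    refine ⟨(subsingleton_homology_subcomplex_iff T h hdim).2 h1,
      (betti_subcomplex_eq_iff T h).2 h2, fun x hx => ?_⟩
    obtain ⟨m, hm, j, hj⟩ := CWComplex.mem_skeleton_iff.1 hx
    exact T.openCell_subset_of_mem (by rw [h m (by exact_mod_cast hm)]; trivial) hj

end Subcomplex

/-- The subcomplex of an `(n + 1)`-dimensional complex made of all cells of dimension at most `n`
and a given set of `(n + 1)`-cells. -/
theorem exists_subcomplex_cells_eq {n : ℕ} (hdim : HasDimension C (n + 1))
    (S : Set (RelCWComplex.cell C (n + 1))) :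
    ∃ T : RelCWComplex.Subcomplex C, (∀ m ≤ n, T.I m = Set.univ) ∧ T.I (n + 1) = S := by
  -- The condition is vacuous unless `m = n + 1`, so every lower cell is included.
  let I (m : ℕ) : Set (RelCWComplex.cell C m) := {b | ∀ h : m = n + 1, h ▸ b ∈ S}
  have hI : ∀ m ≤ n, I m = Set.univ := fun m hm =>
    Set.eq_univ_of_forall fun b h => absurd h (by omega)
  have hle {m : ℕ} (b : RelCWComplex.cell C m) : m ≤ n + 1 := by
    by_contra! h
    exact (hdim.2 m h).false b
  refine ⟨CWComplex.Subcomplex.mk' C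
    (⋃ (m : ℕ) (j : I m), RelCWComplex.openCell (C := C) m j) I ?_ rfl, hI, ?_⟩
  · intro m b x hx
    -- The frontier lies in cells of smaller dimension, hence of dimension at most `n`, and those
    -- are all present.
    rw [← RelCWComplex.cellFrontier_union_openCell_eq_closedCell] at hx
    simp only [Set.mem_iUnion]
    rcases hx with hx | hx
    · obtain ⟨l, hl, j, hj⟩ := CWComplex.mem_skeletonLT_iff.1
        (RelCWComplex.cellFrontier_subset_skeletonLT m b.1 hx)
      have hl' : l < m := by exact_mod_cast hl
      have := hle b.1
      exact ⟨l, ⟨j, by rw [hI l (by omega)]; trivial⟩, hj⟩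
    · exact ⟨m, b, hx⟩
  · ext b
    exact ⟨fun h => h rfl, fun h _ => h⟩

/-! ### The higher matrix-tree theorem -/

theorem det_laplacian_eq [RelCWComplex.FiniteType C] {n r : ℕ}
    {M : Matrix (RelCWComplex.cell C n) (Fin r) ℤ}
    {N : Matrix (Fin r) (RelCWComplex.cell C (n + 1)) ℤ}
    (h : IsRankFactorization (incidence C n) M N) :
    LinearMap.det (laplacian C n) =
      (((N * N.transpose).det * (M.transpose * M).det : ℤ) : ℝ) :=
  h.det_laplacian _

/-- The columns of `M` are a `ℤ`-basis of the boundary lattice, with Gram matrix `Mᵀ * M`. -/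
theorem latticeCovolumeSq_eq [RelCWComplex.FiniteType C] {n r : ℕ}
    {M : Matrix (RelCWComplex.cell C n) (Fin r) ℤ}
    {N : Matrix (Fin r) (RelCWComplex.cell C (n + 1)) ℤ}
    (h : IsRankFactorization (incidence C n) M N) :
    latticeCovolumeSq C n = ((M.transpose * M).det : ℝ) := by
  have hlattice : boundaryLattice C n = Submodule.span ℤ (Set.range h.rangeBasis) := by
    ext x
    refine Iff.trans ?_ (h.mem_span_rangeBasis_iff x).symm
    rw [boundaryLattice, boundaries, boundary_int]
    constructor
    · rintro ⟨_, ⟨v, rfl⟩, hv⟩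
      exact ⟨v, hv⟩
    · rintro ⟨v, hv⟩
      exact ⟨_, ⟨v, rfl⟩, hv⟩
  rw [latticeCovolumeSq, hlattice, ← h.det_gram_rangeBasis]
  exact covolume_sq_eq_det_gram _ _

theorem torsionOrder_eq [RelCWComplex.FiniteType C] (n : ℕ) :
    torsionOrder C n =
      torsionCard (cycles C ℤ n) (LinearMap.range (incidence C n).mulVecLin) := by
  rw [← boundary_int]
  rfl

open Classical in
/-- The sum of the squared torsion orders of the spanning trees. -/
theorem sum_torsionOrder_sq [RelCWComplex.Finite C] {n r : ℕ} (hdim : HasDimension C (n + 1))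
    {M : Matrix (RelCWComplex.cell C n) (Fin r) ℤ}
    {N : Matrix (Fin r) (RelCWComplex.cell C (n + 1)) ℤ}
    (h : IsRankFactorization (incidence C n) M N) :
    ∑ T ∈ spanningTrees C n, (torsionOrder (T : Set X) n : ℤ) ^ 2 =
      (N * N.transpose).det * (torsionOrder C n : ℤ) ^ 2 := by
  have hmem (T : RelCWComplex.Subcomplex C) :
      T ∈ spanningTrees C n ↔ (∀ m ≤ n, T.I m = Set.univ) ∧
        ∃ e : Fin r ≃ RelCWComplex.cell (T : Set X) (n + 1),
          (N.submatrix id (cellInclusion T (n + 1) ∘ e)).det ≠ 0 := by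
    rw [← h.injective_and_finrank_eq_iff, ← isSpanningTree_iff T hdim, spanningTrees,
      Set.Finite.mem_toFinset, Set.mem_ofPred_eq]
  let cells (T : RelCWComplex.Subcomplex C) : Finset (RelCWComplex.cell C (n + 1)) :=
    Finset.univ.filter (· ∈ T.I (n + 1))
  have hcells (T : RelCWComplex.Subcomplex C) (b : RelCWComplex.cell C (n + 1)) :
      b ∈ cells T ↔ b ∈ T.I (n + 1) := by simp [cells]
  let equivCells (T : RelCWComplex.Subcomplex C) :
      RelCWComplex.cell (T : Set X) (n + 1) ≃ cells T :=
    Equiv.subtypeEquivRight fun b => (hcells T b).symm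
  rw [det_mul_eq_sum_powersetCard, Fintype.card_fin, Finset.sum_mul]
  -- A spanning tree is matched with its set of top cells. This is injective, and the `r`-element
  -- sets that it misses have vanishing minor.
  refine Finset.sum_of_injOn cells ?_ ?_ ?_ ?_
  · intro T hT T' hT' hTT'
    refine subcomplex_eq_of_cells_eq hdim ((hmem T).1 hT).1 ((hmem T').1 hT').1 ?_
    ext b
    rw [← hcells, ← hcells, hTT']
  · intro T hT
    obtain ⟨-, e, -⟩ := (hmem T).1 hT
    refine Finset.mem_coe.2 (Finset.mem_powersetCard.2 ⟨Finset.subset_univ _, ?_⟩)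
    rw [← Fintype.card_coe, ← Fintype.card_congr (e.trans (equivCells T)), Fintype.card_fin]
  · intro S hS hnot
    have hcard : Fintype.card (Fin r) = Fintype.card S := by
      rw [Fintype.card_fin, Fintype.card_coe, (Finset.mem_powersetCard.1 hS).2]
    obtain ⟨T, hT, hTS⟩ := exists_subcomplex_cells_eq hdim (S : Set (RelCWComplex.cell C (n + 1)))
    have hTS' : cells T = S := by
      ext b
      rw [hcells, hTS, Finset.mem_coe]
    subst hTS'
    let e := Fintype.equivOfCardEq hcard
    -- A nonzero minor would make the subcomplex with top cells `S` a spanning tree.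
    rw [det_mul_diagonal_mul_transpose N _ e]
    by_contra hne
    refine hnot ⟨T, (hmem T).2 ⟨hT, e.trans (equivCells T).symm, fun h0 => hne ?_⟩, rfl⟩
    have : N.submatrix id (fun i => (e i : RelCWComplex.cell C (n + 1))) =
      N.submatrix id (cellInclusion T (n + 1) ∘ e.trans (equivCells T).symm) := rfl
    rw [this, h0]
    simp
  · intro T hT
    obtain ⟨hTI, e, he⟩ := (hmem T).1 hT
    have hZ : LinearMap.range (incidence C n).mulVecLin ≤ cycles C ℤ n := by
      rw [← boundary_int]
      exact boundaries_le_cycles C ℤ n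
    rw [det_mul_diagonal_mul_transpose N _ (e.trans (equivCells T)), torsionOrder_subcomplex T hTI,
      h.torsionCard_range_submatrix _ e he hZ, ← torsionOrder_eq, Nat.cast_mul, mul_pow,
      Int.natCast_natAbs, sq_abs]
    rfl

end Cellular

end HigherMatrixTree

/-! ### The matrix-tree formula -/

theorem corollaryB {X : Type*} [TopologicalSpace X] [T2Space X] (C : Set X)
    [CWComplex C] [RelCWComplex.Finite C] (hconn : IsConnected C)
    (n : ℕ) (hdim : HigherMatrixTree.HasDimension C (n + 1)) :
    (∃ μ : ℕ, HigherMatrixTree.latticeCovolumeSq C n = μ) ∧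
    LinearMap.det (HigherMatrixTree.laplacian C n) =
      HigherMatrixTree.latticeCovolumeSq C n / (HigherMatrixTree.torsionOrder C n : ℝ) ^ 2 *
        ∑ T ∈ HigherMatrixTree.spanningTrees C n,
          (HigherMatrixTree.torsionOrder (T : Set X) n : ℝ) ^ 2 := by
  obtain ⟨r, M, N, h⟩ := HigherMatrixTree.exists_isRankFactorization
    (HigherMatrixTree.incidence C n)
  have hμ := HigherMatrixTree.latticeCovolumeSq_eq h
  have hθ : (HigherMatrixTree.torsionOrder C n : ℝ) ≠ 0 :=
    Nat.cast_ne_zero.2 (HigherMatrixTree.torsionCard_ne_zero _ _)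
  have hsum : ∑ T ∈ HigherMatrixTree.spanningTrees C n,
      (HigherMatrixTree.torsionOrder (T : Set X) n : ℝ) ^ 2 =
        ((N * N.transpose).det : ℝ) * (HigherMatrixTree.torsionOrder C n : ℝ) ^ 2 := by
    exact_mod_cast HigherMatrixTree.sum_torsionOrder_sq hdim h
  constructor
  · refine ⟨(M.transpose * M).det.toNat, ?_⟩
    -- The integer Gram determinant is nonnegative, being the square of a covolume, so `toNat` loses
    -- nothing.
    have hnonneg : (0 : ℝ) ≤ ((M.transpose * M).det : ℝ) := by
      rw [← hμ]
      exact sq_nonneg _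
    have : (((M.transpose * M).det.toNat : ℤ) : ℝ) = ((M.transpose * M).det : ℝ) := by
      rw [Int.toNat_of_nonneg (by exact_mod_cast hnonneg)]
    rw [hμ, ← this, Int.cast_natCast]
  · rw [HigherMatrixTree.det_laplacian_eq h, hsum, hμ]
    push_cast
    field_simp
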